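/- Let $\mathcal H$ be a finite-dimensional complex Hilbert space, let $\rho_1,\rho_2$ be density operators on $\mathcal H$ (positive semidefinite, unit trace) and let $\sigma_1,\sigma_2$ be positive definite density operators on $\mathcal H$. Let $\varepsilon,\delta\in(0,1)$ with $\frac12\|\rho_1-\rho_2\|_1=\varepsilon$ and $\frac12\|\sigma_1-\sigma_2\|_1\le\delta$, where $\|A\|_1=\operatorname{Tr}\sqrt{A^*A}$. Write $\rho_1-\rho_2=\varepsilon\rho_+-\varepsilon\rho_-$ for the Jordan–Hahn decomposition, i.e. $\rho_\pm=\varepsilon^{-1}(\rho_1-\rho_2)_\pm$ are the rescaled positive and negative parts of $\rho_1-\rho_2$ (so that $\rho_\pm$ are density operators with mutually orthogonal supports). Then $$|D(\rho_1\|\sigma_1)-D(\rho_2\|\sigma_2)|\le \varepsilon\log\!\left(e^{\max\{D_{\max}(\rho_+\|\sigma_1),\,D_{\max}(\rho_-\|\sigma_2)\}}-1\right)+\log\!\left(1+\frac{\delta}{\lambda_{\min}(\sigma)}\right)+h(\varepsilon),$$ where all relative entropies involved are finite and the maximum in the exponent is positive. Here $\log$ is the natural logarithm; $D(\rho\|\sigma)=\operatorname{Tr}(\rho\log\rho-\rho\log\sigma)$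 if $\ker\sigma\subseteq\ker\rho$ and $D(\rho\|\sigma)=\infty$ otherwise; $D_{\max}(\rho\|\sigma)=\inf\{\lambda>0:\rho\le e^{\lambda}\sigma\}$ with respect to the Loewner order; $\lambda_{\min}(\sigma)=\min\{\lambda_{\min}(\sigma_1),\lambda_{\min}(\sigma_2)\}$ is the smaller of the minimal eigenvalues of $\sigma_1$ and $\sigma_2$; and $h(\varepsilon)=-\varepsilon\log\varepsilon-(1-\varepsilon)\log(1-\varepsilon)$. -/

import Mathlib

open scoped ComplexOrder

noncomputable section

namespace QuantumEntropy

variable {n : Type*} [Fintype n] [DecidableEq n]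

/-- Density matrices: positive semidefinite with unit trace. -/
def IsState (ρ : Matrix n n ℂ) : Prop :=
  ρ.PosSemidef ∧ ρ.trace = 1

/-- Positive definite density matrices. -/
def IsPosDefState (σ : Matrix n n ℂ) : Prop :=
  σ.PosDef ∧ σ.trace = 1

/-- The trace norm `Tr √(A* A)`. -/
def traceNorm (A : Matrix n n ℂ) : ℝ :=
  (cfc Real.sqrt (A.conjTranspose * A)).trace.re

/-- The trace distance, half the trace norm of the difference. -/
def traceDist (ρ₁ ρ₂ : Matrix n n ℂ) : ℝ :=
  traceNorm (ρ₁ - ρ₂) / 2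

/-- The matrix logarithm, by functional calculus (with value `0` on the kernel). -/
def matrixLog (A : Matrix n n ℂ) : Matrix n n ℂ :=
  cfc Real.log A

open Classical in
/-- The Umegaki relative entropy `Tr (ρ log ρ - ρ log σ)` if `ker σ ⊆ ker ρ`, and `∞` otherwise. -/
def relEntropy (ρ σ : Matrix n n ℂ) : EReal :=
  if LinearMap.ker σ.mulVecLin ≤ LinearMap.ker ρ.mulVecLin then
    (((ρ * matrixLog ρ - ρ * matrixLog σ).trace.re : ℝ) : EReal)
  else ⊤

/-- The max-relative entropy `inf {t > 0 : ρ ≤ exp t • σ}` for the Loewner order; it is `∞` when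
there is no such `t`. -/
def maxRelEntropy (ρ σ : Matrix n n ℂ) : EReal :=
  sInf {x : EReal | ∃ t : ℝ, 0 < t ∧ (Real.exp t • σ - ρ).PosSemidef ∧ x = (t : EReal)}

/-- The smallest eigenvalue of a Hermitian matrix. -/
def minEigenvalue (A : Matrix n n ℂ) : ℝ :=
  sInf (spectrum ℝ A)

/-- The operator `ρ₊` in `ρ₁ - ρ₂ = ε ρ₊ - ε ρ₋`: the positive part in the Jordan-Hahn
decomposition of `ρ₁ - ρ₂`, divided by `ε`. -/
def jordanPos (ε : ℝ) (ρ₁ ρ₂ : Matrix n n ℂ) : Matrix n n ℂ :=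
  ε⁻¹ • (ρ₁ - ρ₂)⁺

/-- The operator `ρ₋` in `ρ₁ - ρ₂ = ε ρ₊ - ε ρ₋`: the negative part in the Jordan-Hahn
decomposition of `ρ₁ - ρ₂`, divided by `ε`. -/
def jordanNeg (ε : ℝ) (ρ₁ ρ₂ : Matrix n n ℂ) : Matrix n n ℂ :=
  ε⁻¹ • (ρ₁ - ρ₂)⁻

end QuantumEntropy

end

noncomputable section

namespace QuantumEntropy

variable {n : Type*} [Fintype n] [DecidableEq n]

open Matrix Filter Topology

/-! Exchanging the two pairs of states exchanges ρ₊ and ρ₋, so it suffices to bound the signed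
difference. Inserting D(ρ₂‖σ₁) separates the two arguments.

Second argument (`trace_mul_matrixLog_sub_le`): with λ a lower bound for the spectrum of σ₁, σ₁ - σ₂
≥ -δ and 1 ≤ σ₁/λ give σ₂ ≤ (1 + δ/λ)σ₁, and the logarithm is operator monotone.

First argument (`trace_relEntropy_sub_le`): let A, B be the positive and negative parts of ρ₁ - ρ₂,
so that ρ₁ + B = ρ₂ + A. Bounding Tr X log X at this common operator from below by superadditivity
and from above by `trace_mul_matrixLog_gap` compares the entropies at a cost of h(ε). There remains
Tr A(log A - log σ) - Tr B(log B - log σ). If ρ₊ ≤ Mσ, the first term is at most ε log(εM). Moreover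
σ has weight at least 1/M on the support of A, hence at most (M-1)/M on that of B, and coarse
graining bounds minus the second trace by ε log((M-1)/(Mε)). The sum is ε log(M-1).

The gap lemma integrates the derivative Tr C log(Y + tC) + Tr C of Tr X log X along X = Y + tC:
coarse graining to the support of C bounds it by a scalar derivative. Klein's inequality on a
uniform grid replaces the integral. -/

/-! ### Diagonal entries in an eigenbasis. -/

/-- The diagonal entry of `Z` at the `i`-th vector of an eigenbasis of the Hermitian matrix `A`. -/
def eigenDiag {A : Matrix n n ℂ} (hA : A.IsHermitian) (Z : Matrix n n ℂ) (i : n) : ℝ :=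
  ((star (hA.eigenvectorUnitary : Matrix n n ℂ) * Z * hA.eigenvectorUnitary) i i).re

lemma cfc_id_self {A : Matrix n n ℂ} (hA : A.IsHermitian) : cfc (fun x : ℝ => x) A = A :=
  cfc_id' ℝ A hA.isSelfAdjoint

section eigenDiag

variable {A : Matrix n n ℂ} (hA : A.IsHermitian)

lemma eigenDiag_add (Y Z : Matrix n n ℂ) (i : n) :
    eigenDiag hA (Y + Z) i = eigenDiag hA Y i + eigenDiag hA Z i := by
  simp [eigenDiag, mul_add, add_mul]

lemma eigenDiag_sub (Y Z : Matrix n n ℂ) (i : n) :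
    eigenDiag hA (Y - Z) i = eigenDiag hA Y i - eigenDiag hA Z i := by
  simp [eigenDiag, mul_sub, sub_mul]

lemma eigenDiag_smul (c : ℝ) (Z : Matrix n n ℂ) (i : n) :
    eigenDiag hA (c • Z) i = c * eigenDiag hA Z i := by
  simp [eigenDiag]

lemma eigenDiag_one (i : n) : eigenDiag hA 1 i = 1 := by
  simp [eigenDiag]

lemma eigenDiag_nonneg {Z : Matrix n n ℂ} (hZ : Z.PosSemidef) (i : n) :
    0 ≤ eigenDiag hA Z i := by
  have h := hZ.conjTranspose_mul_mul_same (hA.eigenvectorUnitary : Matrix n n ℂ)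
  exact (Complex.le_def.1 (h.diag_nonneg (i := i))).1

lemma eigenDiag_pos {Z : Matrix n n ℂ} (hZ : Z.PosDef) (i : n) :
    0 < eigenDiag hA Z i := by
  have h := hZ.conjTranspose_mul_mul_same (B := (hA.eigenvectorUnitary : Matrix n n ℂ))
    (Matrix.mulVec_injective_of_isUnit (Unitary.toUnits hA.eigenvectorUnitary).isUnit)
  exact (Complex.lt_def.1 (h.diag_pos (i := i))).1

lemma eigenDiag_mono {Y Z : Matrix n n ℂ} (h : (Z - Y).PosSemidef) (i : n) :
    eigenDiag hA Y i ≤ eigenDiag hA Z i := by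
  have := eigenDiag_nonneg hA h i
  rw [eigenDiag_sub] at this
  linarith

lemma sum_eigenDiag (Z : Matrix n n ℂ) : ∑ i, eigenDiag hA Z i = Z.trace.re := by
  have h : Z.trace = (star (hA.eigenvectorUnitary : Matrix n n ℂ) * Z *
      hA.eigenvectorUnitary).trace := by
    rw [Matrix.trace_mul_comm, ← mul_assoc]
    simp
  rw [h]
  simp [Matrix.trace, eigenDiag]

lemma cfc_eq_conj_diagonal (g : ℝ → ℝ) :
    cfc g A = (hA.eigenvectorUnitary : Matrix n n ℂ) *
      diagonal (fun i => (g (hA.eigenvalues i) : ℂ)) *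
        star (hA.eigenvectorUnitary : Matrix n n ℂ) := by
  rw [hA.cfc_eq, IsHermitian.cfc, Unitary.conjStarAlgAut_apply]
  rfl

lemma trace_cfc_mul (g : ℝ → ℝ) (Z : Matrix n n ℂ) :
    (cfc g A * Z).trace.re = ∑ i, g (hA.eigenvalues i) * eigenDiag hA Z i := by
  rw [cfc_eq_conj_diagonal hA, mul_assoc, mul_assoc, Matrix.trace_mul_comm, mul_assoc,
    Matrix.trace]
  simp [eigenDiag, Matrix.diagonal_mul]

lemma trace_cfc (g : ℝ → ℝ) : (cfc g A).trace.re = ∑ i, g (hA.eigenvalues i) := by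
  have := trace_cfc_mul hA g 1
  simpa [eigenDiag_one] using this

lemma trace_mul_eq_sum (Z : Matrix n n ℂ) :
    (A * Z).trace.re = ∑ i, hA.eigenvalues i * eigenDiag hA Z i := by
  have := trace_cfc_mul hA (fun x => x) Z
  rwa [cfc_id_self hA] at this

lemma eigenDiag_cfc_self (g : ℝ → ℝ) (i : n) :
    eigenDiag hA (cfc g A) i = g (hA.eigenvalues i) := by
  rw [eigenDiag, cfc_eq_conj_diagonal hA]
  simp [mul_assoc]
  simp [← mul_assoc]

lemma trace_mul_matrixLog :
    (A * matrixLog A).trace.re = ∑ i, hA.eigenvalues i * Real.log (hA.eigenvalues i) := by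
  rw [trace_mul_eq_sum hA]
  simp [matrixLog, eigenDiag_cfc_self]

/-- The weights are the squared overlaps of one eigenvector of `A` with an eigenbasis of `Z`. They
do not depend on `g`, so `g = 1` gives their sum. -/
lemma exists_weights_eigenDiag_cfc {Z : Matrix n n ℂ} (hZ : Z.IsHermitian) (i : n) :
    ∃ w : n → ℝ, (∀ j, 0 ≤ w j) ∧ ∑ j, w j = 1 ∧
      ∀ g : ℝ → ℝ, eigenDiag hA (cfc g Z) i = ∑ j, w j * g (hZ.eigenvalues j) := by
  set V : Matrix n n ℂ := star (hA.eigenvectorUnitary : Matrix n n ℂ) * hZ.eigenvectorUnitary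
    with hV
  have key : ∀ g : ℝ → ℝ,
      eigenDiag hA (cfc g Z) i = ∑ j, Complex.normSq (V i j) * g (hZ.eigenvalues j) := by
    intro g
    have h : star (hA.eigenvectorUnitary : Matrix n n ℂ) * cfc g Z * hA.eigenvectorUnitary =
        V * diagonal (fun i => (g (hZ.eigenvalues i) : ℂ)) * star V := by
      rw [cfc_eq_conj_diagonal hZ, hV, star_mul, star_star]
      simp only [mul_assoc]
    rw [eigenDiag, h, Matrix.mul_apply, Complex.re_sum]
    refine Finset.sum_congr rfl fun j _ => ?_
    rw [Matrix.mul_diagonal, Matrix.star_apply, mul_right_comm, Complex.star_def,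
      Complex.mul_conj, ← Complex.ofReal_mul, Complex.ofReal_re]
  refine ⟨fun j => Complex.normSq (V i j), fun j => Complex.normSq_nonneg _, ?_, key⟩
  have h1 := key (fun _ => 1)
  rw [cfc_const_one ℝ Z hZ.isSelfAdjoint, eigenDiag_one] at h1
  simpa using h1.symm

/-- Jensen's inequality for the logarithm in a vector state. -/
lemma eigenDiag_matrixLog_le {Z : Matrix n n ℂ} (hZ : Z.PosDef) (i : n) :
    eigenDiag hA (matrixLog Z) i ≤ Real.log (eigenDiag hA Z i) := by
  obtain ⟨w, hw0, hw1, hw⟩ := exists_weights_eigenDiag_cfc hA hZ.isHermitian i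
  have h := hw (fun x => x)
  rw [cfc_id_self hZ.isHermitian] at h
  rw [matrixLog, hw, h]
  have := strictConcaveOn_log_Ioi.concaveOn.le_map_sum (t := Finset.univ) (w := w)
    (p := hZ.isHermitian.eigenvalues) (fun j _ => hw0 j) hw1
    (fun j _ => hZ.eigenvalues_pos j)
  simpa using this

end eigenDiag

/-! ### Klein's inequality and operator monotonicity of the logarithm. -/

omit [Fintype n] in
lemma posDef_add_smul_one {A : Matrix n n ℂ} (hA : A.PosSemidef) {η : ℝ} (hη : 0 < η) :
    (A + η • (1 : Matrix n n ℂ)).PosDef :=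
  Matrix.PosDef.posSemidef_add hA (Matrix.PosDef.one.smul hη)

/-- Klein's inequality for `x log x`. -/
lemma klein {Y Z : Matrix n n ℂ} (hY : Y.PosDef) (hZ : Z.PosDef) :
    (Z * matrixLog Z).trace.re - (Y * matrixLog Y).trace.re ≤
      ((Z - Y) * matrixLog Z).trace.re + (Z - Y).trace.re := by
  have hH := hY.isHermitian
  have h1 := trace_mul_matrixLog hH
  have h2 := trace_mul_eq_sum hH (matrixLog Z)
  have h3 := sum_eigenDiag hH Z
  have h4 : Y.trace.re = ∑ i, hH.eigenvalues i := by
    have := trace_cfc hH (fun x => x)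
    rwa [cfc_id_self hH] at this
  have key : ∀ i, hH.eigenvalues i * eigenDiag hH (matrixLog Z) i -
      hH.eigenvalues i * Real.log (hH.eigenvalues i) ≤
        eigenDiag hH Z i - hH.eigenvalues i := by
    intro i
    have hy := hY.eigenvalues_pos i
    have hz := eigenDiag_pos hH hZ i
    have hj := mul_le_mul_of_nonneg_left (eigenDiag_matrixLog_le hH hZ i) hy.le
    -- After Jensen, only the scalar inequality y log(z/y) ≤ z - y is needed.
    have hl := Real.log_le_sub_one_of_pos (div_pos hz hy)
    rw [Real.log_div hz.ne' hy.ne'] at hl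
    have hl' := mul_le_mul_of_nonneg_left hl hy.le
    have : hH.eigenvalues i * (eigenDiag hH Z i / hH.eigenvalues i - 1) =
      eigenDiag hH Z i - hH.eigenvalues i := by field_simp
    rw [this] at hl'
    have hj' : hY.isHermitian.eigenvalues i = hH.eigenvalues i := rfl
    nlinarith
  have hs := Finset.sum_le_sum (s := Finset.univ) fun i _ => key i
  simp only [Finset.sum_sub_distrib] at hs
  simp only [sub_mul, Matrix.trace_sub, Complex.sub_re]
  linarith

section monotone

open scoped MatrixOrder Matrix.Norms.L2Operator

/-- Operator monotonicity of the logarithm. -/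
lemma matrixLog_mono {Y Z : Matrix n n ℂ} (hY : Y.PosDef) (h : (Z - Y).PosSemidef) :
    (matrixLog Z - matrixLog Y).PosSemidef := by
  have : Y ≤ Z := h
  exact CFC.log_le_log this (ha := hY.isStrictlyPositive)

end monotone

lemma matrixLog_smul {Z : Matrix n n ℂ} (hZ : Z.PosDef) {c : ℝ} (hc : 0 < c) :
    matrixLog (c • Z) = Real.log c • (1 : Matrix n n ℂ) + matrixLog Z := by
  have hH := hZ.isHermitian
  have h0 : c • Z = cfc (fun x => c * x) Z := by
    rw [cfc_const_mul c (fun x : ℝ => x) Z, cfc_id_self hH]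
  have hfin := Matrix.finite_real_spectrum (A := Z)
  have h1 : matrixLog (c • Z) = cfc (fun x => Real.log (c * x)) Z := by
    rw [matrixLog, h0]
    exact (cfc_comp' Real.log (fun x => c * x) Z ((hfin.image _).continuousOn _) (by fun_prop)
      hH.isSelfAdjoint).symm
  have h2 : cfc (fun x => Real.log (c * x)) Z = cfc (fun x => Real.log c + Real.log x) Z := by
    refine cfc_congr fun x hx => ?_
    rw [hH.spectrum_real_eq_range_eigenvalues] at hx
    obtain ⟨i, rfl⟩ := hx
    exact Real.log_mul hc.ne' (hZ.eigenvalues_pos i).ne'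
  rw [h1, h2, cfc_const_add _ _ _ (hfin.continuousOn _) hH.isSelfAdjoint, matrixLog,
    Algebra.algebraMap_eq_smul_one]

lemma trace_mul_nonneg {C D : Matrix n n ℂ} (hC : C.PosSemidef) (hD : D.PosSemidef) :
    0 ≤ (C * D).trace.re := by
  rw [trace_mul_eq_sum hC.isHermitian]
  exact Finset.sum_nonneg fun i _ => mul_nonneg (hC.eigenvalues_nonneg i)
    (eigenDiag_nonneg _ hD i)

/-! ### Perturbation to positive definite matrices, and superadditivity. -/

lemma matrixLog_cfc {A : Matrix n n ℂ} (hA : A.IsHermitian) (g : ℝ → ℝ) :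
    matrixLog (cfc g A) = cfc (fun x => Real.log (g x)) A := by
  have hfin := Matrix.finite_real_spectrum (A := A)
  exact (cfc_comp' Real.log g A ((hfin.image _).continuousOn _) (hfin.continuousOn _)
    hA.isSelfAdjoint).symm

lemma trace_cfc_mul_matrixLog_cfc {A : Matrix n n ℂ} (hA : A.IsHermitian) (g : ℝ → ℝ) :
    (cfc g A * matrixLog (cfc g A)).trace.re =
      ∑ i, g (hA.eigenvalues i) * Real.log (g (hA.eigenvalues i)) := by
  rw [trace_cfc_mul hA, matrixLog_cfc hA]
  simp [eigenDiag_cfc_self]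

lemma add_smul_one_eq_cfc {A : Matrix n n ℂ} (hA : A.IsHermitian) (η : ℝ) :
    A + η • (1 : Matrix n n ℂ) = cfc (fun x => x + η) A := by
  rw [cfc_add_const η (fun x : ℝ => x) A (by fun_prop) hA.isSelfAdjoint, cfc_id_self hA,
    Algebra.algebraMap_eq_smul_one]

/-- Continuity of x log x at 0 makes the kernel of `A` harmless. The factor `c` is there because
shifting two summands by η shifts their sum by 2η. -/
lemma tendsto_trace_perturb {A : Matrix n n ℂ} (hA : A.IsHermitian) {c : ℝ} :
    Tendsto (fun η : ℝ => ((A + (c * η) • (1 : Matrix n n ℂ)) *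
      matrixLog (A + (c * η) • (1 : Matrix n n ℂ))).trace.re) (𝓝[>] 0)
      (𝓝 (A * matrixLog A).trace.re) := by
  rw [trace_mul_matrixLog hA]
  simp only [add_smul_one_eq_cfc hA, trace_cfc_mul_matrixLog_cfc hA]
  have h : Continuous fun η : ℝ => ∑ i, (hA.eigenvalues i + c * η) *
      Real.log (hA.eigenvalues i + c * η) :=
    continuous_finsetSum _ fun i _ => Real.continuous_mul_log.comp (by fun_prop)
  have := (h.tendsto 0).mono_left (nhdsWithin_le_nhds (s := Set.Ioi 0))
  simpa using this

/-- The right side splits into Tr Y log(Y + Z) and Tr Z log(Y + Z), and the logarithm is operator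
monotone. -/
lemma trace_mul_matrixLog_superadditive_of_posDef {Y Z : Matrix n n ℂ} (hY : Y.PosDef)
    (hZ : Z.PosDef) :
    (Y * matrixLog Y).trace.re + (Z * matrixLog Z).trace.re ≤
      ((Y + Z) * matrixLog (Y + Z)).trace.re := by
  have h1 := trace_mul_nonneg hY.posSemidef
    (matrixLog_mono hY (Z := Y + Z) (by simpa using hZ.posSemidef))
  have h2 := trace_mul_nonneg hZ.posSemidef
    (matrixLog_mono hZ (Z := Y + Z) (by simpa using hY.posSemidef))
  simp only [mul_sub, add_mul, trace_sub, trace_add, Complex.sub_re, Complex.add_re] at *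
  linarith

/-- Superadditivity of `Tr (A log A)` on positive semidefinite matrices. -/
lemma trace_mul_matrixLog_superadditive {Y Z : Matrix n n ℂ} (hY : Y.PosSemidef)
    (hZ : Z.PosSemidef) :
    (Y * matrixLog Y).trace.re + (Z * matrixLog Z).trace.re ≤
      ((Y + Z) * matrixLog (Y + Z)).trace.re := by
  refine le_of_tendsto_of_tendsto ((tendsto_trace_perturb hY.isHermitian (c := 1)).add
    (tendsto_trace_perturb hZ.isHermitian (c := 1)))
    (tendsto_trace_perturb (hY.add hZ).isHermitian (c := 2)) ?_
  filter_upwards [self_mem_nhdsWithin] with η hη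
  have hη : 0 < η := hη
  have := trace_mul_matrixLog_superadditive_of_posDef
    (posDef_add_smul_one hY (η := 1 * η) (by linarith))
    (posDef_add_smul_one hZ (η := 1 * η) (by linarith))
  have e : Y + (1 * η) • (1 : Matrix n n ℂ) + (Z + (1 * η) • (1 : Matrix n n ℂ)) =
      Y + Z + (2 * η) • (1 : Matrix n n ℂ) := by
    rw [two_mul, add_smul, one_mul]; abel
  rwa [e] at this

/-- If `A ≤ S` then `Tr (A log A) ≤ Tr (A log S)`. -/
lemma trace_mul_matrixLog_le_of_le {A S : Matrix n n ℂ} (hA : A.PosSemidef) (hS : S.PosDef)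
    (h : (S - A).PosSemidef) :
    (A * matrixLog A).trace.re ≤ (A * matrixLog S).trace.re := by
  have hAH := hA.isHermitian
  have hSH := hS.isHermitian
  have hl : Tendsto (fun η : ℝ => (A * matrixLog (A + η • (1 : Matrix n n ℂ))).trace.re)
      (𝓝[>] 0) (𝓝 (A * matrixLog A).trace.re) := by
    rw [trace_mul_matrixLog hAH]
    simp only [add_smul_one_eq_cfc hAH, trace_mul_eq_sum hAH, matrixLog_cfc hAH,
      eigenDiag_cfc_self]
    refine tendsto_finsetSum _ fun i _ => ?_
    -- On the kernel of `A`, log η diverges but carries the factor zero.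
    rcases eq_or_ne (hAH.eigenvalues i) 0 with h0 | h0
    · simp [h0]
    · refine Tendsto.const_mul _ ?_
      have hc : ContinuousAt (fun η : ℝ => Real.log (hAH.eigenvalues i + η)) 0 :=
        ContinuousAt.log (by fun_prop) (by simpa using h0)
      simpa using hc.tendsto.mono_left (nhdsWithin_le_nhds (s := Set.Ioi 0))
  have hr : Tendsto (fun η : ℝ => (A * matrixLog (S + η • (1 : Matrix n n ℂ))).trace.re)
      (𝓝[>] 0) (𝓝 (A * matrixLog S).trace.re) := by
    simp only [fun Z : Matrix n n ℂ => Matrix.trace_mul_comm A Z, matrixLog,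
      add_smul_one_eq_cfc hSH]
    simp only [← matrixLog.eq_1, matrixLog_cfc hSH]
    simp only [matrixLog, trace_cfc_mul hSH]
    refine tendsto_finsetSum _ fun i _ => Tendsto.mul_const _ ?_
    have hc : ContinuousAt (fun η : ℝ => Real.log (hSH.eigenvalues i + η)) 0 :=
      ContinuousAt.log (by fun_prop) (by simpa using (hS.eigenvalues_pos i).ne')
    simpa using hc.tendsto.mono_left (nhdsWithin_le_nhds (s := Set.Ioi 0))
  refine le_of_tendsto_of_tendsto hl hr ?_
  filter_upwards [self_mem_nhdsWithin] with η hη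
  have := trace_mul_nonneg hA (matrixLog_mono (posDef_add_smul_one hA hη)
    (Z := S + η • (1 : Matrix n n ℂ)) (by simpa using h))
  simp only [mul_sub, trace_sub, Complex.sub_re] at this
  linarith

/-! ### Coarse graining and the superadditivity gap. -/

/-- A lower bound on the relative entropy of `g(A)` and `S`, by coarse graining `S` to the support
of `g(A)`. -/
lemma trace_cfc_mul_matrixLog_sub_le {A S : Matrix n n ℂ} (hA : A.IsHermitian) (hS : S.PosDef)
    {g : ℝ → ℝ} (hg : ∀ x, 0 ≤ g x) {ε p : ℝ} (hε : ∑ i, g (hA.eigenvalues i) = ε)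
    (hε0 : 0 < ε) (hp0 : 0 < p)
    (hp : ∑ i with 0 < g (hA.eigenvalues i), eigenDiag hA S i ≤ p) :
    (cfc g A * matrixLog S).trace.re - (cfc g A * matrixLog (cfc g A)).trace.re ≤
      ε * Real.log (p / ε) := by
  rw [trace_cfc_mul_matrixLog_cfc hA, trace_cfc_mul hA, ← Finset.sum_sub_distrib]
  have key : ∀ i, g (hA.eigenvalues i) * eigenDiag hA (matrixLog S) i -
      g (hA.eigenvalues i) * Real.log (g (hA.eigenvalues i)) ≤
      g (hA.eigenvalues i) * (Real.log (p / ε) - 1) +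
        ε / p * (if 0 < g (hA.eigenvalues i) then eigenDiag hA S i else 0) := by
    intro i
    have hs := eigenDiag_pos hA hS i
    have hj := eigenDiag_matrixLog_le hA hS i
    generalize g (hA.eigenvalues i) = a, hg (hA.eigenvalues i) = ha at *
    rcases ha.eq_or_lt with h0 | h0
    · simp [← h0]
    · rw [if_pos h0]
      -- The tangent bound is taken where the diagonal of `S` is proportional to `a` with ratio p /
      -- ε, the equality case of the log-sum inequality.
      have hl := Real.log_le_sub_one_of_pos
        (div_pos (mul_pos (eigenDiag_pos hA hS i) hε0) (mul_pos h0 hp0))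
      rw [Real.log_div (by positivity) (by positivity), Real.log_mul hs.ne' hε0.ne',
        Real.log_mul h0.ne' hp0.ne'] at hl
      rw [Real.log_div hp0.ne' hε0.ne']
      have hm := mul_le_mul_of_nonneg_left hl h0.le
      have hm' := mul_le_mul_of_nonneg_left hj h0.le
      have e : a * (eigenDiag hA S i * ε / (a * p) - 1) = ε / p * eigenDiag hA S i - a := by
        field_simp
      rw [e] at hm
      nlinarith
  refine (Finset.sum_le_sum fun i _ => key i).trans ?_
  rw [Finset.sum_add_distrib, ← Finset.sum_mul, hε, ← Finset.mul_sum, ← Finset.sum_filter]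
  have : ε / p * ∑ i with 0 < g (hA.eigenvalues i), eigenDiag hA S i ≤ ε / p * p :=
    mul_le_mul_of_nonneg_left hp (by positivity)
  rw [div_mul_cancel₀ _ hp0.ne'] at this
  nlinarith

/-- The tangent line at `x` lies below the convex function x log x. -/
lemma mul_log_add_mul_le {x h : ℝ} (hx : 0 < x) (hh : 0 ≤ h) :
    h * (Real.log x + 1) ≤ (x + h) * Real.log (x + h) - x * Real.log x := by
  have hy : 0 < x + h := by linarith
  have hl := Real.log_le_sub_one_of_pos (div_pos hx hy)
  rw [Real.log_div hx.ne' hy.ne'] at hl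
  have hm := mul_le_mul_of_nonneg_left hl hy.le
  have e : (x + h) * (x / (x + h) - 1) = -h := by field_simp; ring
  rw [e] at hm
  nlinarith

lemma posSemidef_cfc {A : Matrix n n ℂ} (hA : A.IsHermitian) {g : ℝ → ℝ}
    (hg : ∀ i, 0 ≤ g (hA.eigenvalues i)) : (cfc g A).PosSemidef := by
  rw [cfc_eq_conj_diagonal hA]
  have : (diagonal fun i => (g (hA.eigenvalues i) : ℂ)).PosSemidef :=
    PosSemidef.diagonal fun i => by simpa using hg i
  exact this.mul_mul_conjTranspose_same _

section gap

variable {A : Matrix n n ℂ} (hA : A.IsHermitian) {g : ℝ → ℝ} (hg : ∀ x, 0 ≤ g x) {ε p : ℝ}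
  (hε : ∑ i, g (hA.eigenvalues i) = ε) (hε0 : 0 < ε)

include hg hε hε0

/-- One grid step from `s` to `s + h`. Klein's inequality puts the logarithm at the right endpoint,
where the weight on the support is at most p + (s + h)ε; the scalar increment therefore starts
there, one step late. -/
lemma trace_mul_matrixLog_step {Y : Matrix n n ℂ} (hY : Y.PosDef) (hp0 : 0 < p)
    (hp : ∑ i with 0 < g (hA.eigenvalues i), eigenDiag hA Y i ≤ p) {s h : ℝ} (hs : 0 ≤ s)
    (hh : 0 ≤ h) :
    ((Y + (s + h) • cfc g A) * matrixLog (Y + (s + h) • cfc g A)).trace.re -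
      ((Y + s • cfc g A) * matrixLog (Y + s • cfc g A)).trace.re ≤
    h * ((cfc g A * matrixLog (cfc g A)).trace.re - ε * Real.log ε) +
      ((p + (s + h) * ε + h * ε) * Real.log (p + (s + h) * ε + h * ε) -
        (p + (s + h) * ε) * Real.log (p + (s + h) * ε)) := by
  have hC := posSemidef_cfc hA fun i => hg _
  have hpd : ∀ t : ℝ, 0 ≤ t → (Y + t • cfc g A).PosDef := fun t ht =>
    hY.add_posSemidef (hC.smul ht)
  have hk := klein (hpd s hs) (hpd (s + h) (by linarith))
  have e : Y + (s + h) • cfc g A - (Y + s • cfc g A) = h • cfc g A := by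
    rw [add_smul]; abel
  have ht : (cfc g A).trace.re = ε := by rw [trace_cfc hA, hε]
  rw [e] at hk
  simp only [smul_mul_assoc, trace_smul, Complex.smul_re, ht, smul_eq_mul] at hk
  have hq0 : 0 < p + (s + h) * ε := by positivity
  have hq : ∑ i with 0 < g (hA.eigenvalues i), eigenDiag hA (Y + (s + h) • cfc g A) i ≤
      p + (s + h) * ε := by
    simp only [eigenDiag_add, eigenDiag_smul, eigenDiag_cfc_self, Finset.sum_add_distrib,
      ← Finset.mul_sum]
    have : ∑ i with 0 < g (hA.eigenvalues i), g (hA.eigenvalues i) ≤ ε := by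
      rw [← hε]
      exact Finset.sum_le_sum_of_subset_of_nonneg (Finset.filter_subset _ _)
        fun i _ _ => hg _
    have := mul_le_mul_of_nonneg_left this (by linarith : 0 ≤ s + h)
    linarith
  have hb := trace_cfc_mul_matrixLog_sub_le hA (hpd (s + h) (by linarith)) hg hε hε0 hq0 hq
  rw [Real.log_div hq0.ne' hε0.ne'] at hb
  have hb' := mul_le_mul_of_nonneg_left hb hh
  have hc := mul_log_add_mul_le hq0 (mul_nonneg hh hε0.le)
  nlinarith

lemma trace_mul_matrixLog_gap_of_posDef {Y : Matrix n n ℂ} (hY : Y.PosDef) (hp0 : 0 < p)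
    (hp : ∑ i with 0 < g (hA.eigenvalues i), eigenDiag hA Y i ≤ p) :
    ((Y + cfc g A) * matrixLog (Y + cfc g A)).trace.re - (Y * matrixLog Y).trace.re ≤
      (cfc g A * matrixLog (cfc g A)).trace.re - ε * Real.log ε +
        ((p + ε) * Real.log (p + ε) - p * Real.log p) := by
  have hN : ∀ N : ℕ, ((Y + cfc g A) * matrixLog (Y + cfc g A)).trace.re -
      (Y * matrixLog Y).trace.re ≤
      (cfc g A * matrixLog (cfc g A)).trace.re - ε * Real.log ε +
        ((p + ε + 1 / ((N : ℝ) + 1) * ε) * Real.log (p + ε + 1 / ((N : ℝ) + 1) * ε) -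
          (p + 1 / ((N : ℝ) + 1) * ε) * Real.log (p + 1 / ((N : ℝ) + 1) * ε)) := by
    intro N
    set h : ℝ := 1 / ((N : ℝ) + 1) with hh
    have hpos : 0 < h := by positivity
    have hNh : ((N + 1 : ℕ) : ℝ) * h = 1 := by rw [hh]; push_cast; field_simp
    -- The scalar increments telescope; their one-step delay leaves the offset h * ε, which vanishes
    -- as the grid is refined.
    have hind : ∀ k : ℕ,
        ((Y + (k * h) • cfc g A) * matrixLog (Y + (k * h) • cfc g A)).trace.re -
          (Y * matrixLog Y).trace.re ≤
        k * h * ((cfc g A * matrixLog (cfc g A)).trace.re - ε * Real.log ε) +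
          ((p + (k * h) * ε + h * ε) * Real.log (p + (k * h) * ε + h * ε) -
            (p + h * ε) * Real.log (p + h * ε)) := by
      intro k
      induction k with
      | zero => simp
      | succ k ih =>
        have := trace_mul_matrixLog_step hA hg hε hε0 hY hp0 hp (s := k * h) (h := h)
          (by positivity) hpos.le
        have e : ((k + 1 : ℕ) : ℝ) * h = k * h + h := by push_cast; ring
        have e' : p + (k * h) * ε + h * ε = p + (k * h + h) * ε := by ring
        rw [e]
        rw [e'] at ih
        linarith
    have := hind (N + 1)
    rwa [hNh, one_smul, one_mul, one_mul] at this
  have hφ : Continuous fun t : ℝ => (p + ε + t * ε) * Real.log (p + ε + t * ε) -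
      (p + t * ε) * Real.log (p + t * ε) :=
    (Real.continuous_mul_log.comp (f := fun t : ℝ => p + ε + t * ε) (by fun_prop)).sub
      (Real.continuous_mul_log.comp (f := fun t : ℝ => p + t * ε) (by fun_prop))
  have hlim := ((hφ.tendsto 0).comp (tendsto_one_div_add_atTop_nhds_zero_nat (𝕜 := ℝ))).const_add
    ((cfc g A * matrixLog (cfc g A)).trace.re - ε * Real.log ε)
  have := ge_of_tendsto' hlim hN
  simpa using this

/-- The superadditivity gap of `Tr (A log A)` at `Y` and `g(A)` is bounded by that of the total
weights, where only the weight of `Y` on the support of `g(A)` matters. -/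
lemma trace_mul_matrixLog_gap {Y : Matrix n n ℂ} (hY : Y.PosSemidef) (hp0 : 0 < p)
    (hp : ∑ i with 0 < g (hA.eigenvalues i), eigenDiag hA Y i ≤ p) :
    ((Y + cfc g A) * matrixLog (Y + cfc g A)).trace.re - (Y * matrixLog Y).trace.re ≤
      (cfc g A * matrixLog (cfc g A)).trace.re - ε * Real.log ε +
        ((p + ε) * Real.log (p + ε) - p * Real.log p) := by
  have hC := posSemidef_cfc hA fun i => hg _
  have hφ : Continuous fun η : ℝ =>
      (p + η * Fintype.card n + ε) * Real.log (p + η * Fintype.card n + ε) -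
      (p + η * Fintype.card n) * Real.log (p + η * Fintype.card n) :=
    (Real.continuous_mul_log.comp (f := fun η : ℝ => p + η * Fintype.card n + ε)
      (by fun_prop)).sub
      (Real.continuous_mul_log.comp (f := fun η : ℝ => p + η * Fintype.card n) (by fun_prop))
  have hlim := ((hφ.tendsto 0).mono_left (nhdsWithin_le_nhds (s := Set.Ioi 0))).const_add
    ((cfc g A * matrixLog (cfc g A)).trace.re - ε * Real.log ε)
  simp only [zero_mul, add_zero] at hlim
  refine le_of_tendsto_of_tendsto ((tendsto_trace_perturb (hY.add hC).isHermitian (c := 1)).sub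
    (tendsto_trace_perturb hY.isHermitian (c := 1))) hlim ?_
  filter_upwards [self_mem_nhdsWithin] with η hη
  have hη : 0 < η := hη
  rw [one_mul, add_right_comm]
  refine trace_mul_matrixLog_gap_of_posDef hA hg hε hε0 (posDef_add_smul_one hY hη)
    (by positivity) ?_
  simp only [eigenDiag_add, eigenDiag_smul, eigenDiag_one, mul_one, Finset.sum_add_distrib,
    Finset.sum_const, nsmul_eq_mul]
  -- The added η • 1 has weight η times the rank of g(A), at most η times the dimension.
  have : (((Finset.univ.filter fun i => 0 < g (hA.eigenvalues i)).card : ℕ) : ℝ) ≤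
      Fintype.card n := by exact_mod_cast Finset.card_le_univ _
  nlinarith

end gap

/-! ### Jordan–Hahn parts and the trace norm. -/

lemma posPart_eq_cfc (A : Matrix n n ℂ) : A⁺ = cfc (fun x : ℝ => x⁺) A := by
  rw [CFC.posPart_def, cfcₙ_eq_cfc]

lemma negPart_eq_cfc (A : Matrix n n ℂ) : A⁻ = cfc (fun x : ℝ => x⁻) A := by
  rw [CFC.negPart_def, cfcₙ_eq_cfc]

lemma posPart_sub_negPart_eq {A : Matrix n n ℂ} (hA : A.IsHermitian) : A⁺ - A⁻ = A :=
  CFC.posPart_sub_negPart A hA.isSelfAdjoint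

lemma jordanPos_swap (ε : ℝ) (ρ₁ ρ₂ : Matrix n n ℂ) :
    jordanPos ε ρ₂ ρ₁ = jordanNeg ε ρ₁ ρ₂ := by
  rw [jordanPos, jordanNeg, ← neg_sub ρ₁ ρ₂, CFC.posPart_neg]

lemma traceNorm_eq_sum_abs {A : Matrix n n ℂ} (hA : A.IsHermitian) :
    traceNorm A = ∑ i, |hA.eigenvalues i| := by
  have hfin := Matrix.finite_real_spectrum (A := A)
  have h : A.conjTranspose * A = cfc (fun x : ℝ => x * x) A := by
    rw [cfc_mul (fun x : ℝ => x) (fun x : ℝ => x) A, cfc_id_self hA, hA.eq]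
  have h2 : cfc Real.sqrt (A.conjTranspose * A) = cfc (fun x : ℝ => |x|) A := by
    rw [h, ← cfc_comp' Real.sqrt (fun x : ℝ => x * x) A (by fun_prop) (by fun_prop)
      hA.isSelfAdjoint]
    simp only [Real.sqrt_mul_self_eq_abs]
  rw [traceNorm, h2, trace_cfc hA]

lemma sum_eigenvalues_eq_trace {A : Matrix n n ℂ} (hA : A.IsHermitian) :
    ∑ i, hA.eigenvalues i = A.trace.re := by
  have := trace_cfc hA (fun x => x)
  rwa [cfc_id_self hA, eq_comm] at this

lemma sum_posPart_eigenvalues {A : Matrix n n ℂ} (hA : A.IsHermitian) (h0 : A.trace = 0) :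
    ∑ i, (hA.eigenvalues i)⁺ = traceNorm A / 2 := by
  have h1 := sum_eigenvalues_eq_trace hA
  rw [h0, Complex.zero_re] at h1
  have h2 : ∀ x : ℝ, x⁺ = (|x| + x) / 2 := fun x => by
    rcases le_total 0 x with h | h
    · rw [posPart_eq_self.2 h, abs_of_nonneg h]; ring
    · rw [posPart_eq_zero.2 h, abs_of_nonpos h]; ring
  simp only [h2]
  rw [← Finset.sum_div, Finset.sum_add_distrib, h1, traceNorm_eq_sum_abs hA, add_zero]

lemma sum_negPart_eigenvalues {A : Matrix n n ℂ} (hA : A.IsHermitian) (h0 : A.trace = 0) :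
    ∑ i, (hA.eigenvalues i)⁻ = traceNorm A / 2 := by
  rw [← sum_posPart_eigenvalues hA h0, ← sub_eq_zero, ← Finset.sum_sub_distrib]
  have h1 := sum_eigenvalues_eq_trace hA
  rw [h0, Complex.zero_re] at h1
  rw [← neg_eq_zero, ← Finset.sum_neg_distrib, ← h1]
  refine Finset.sum_congr rfl fun i _ => ?_
  rw [neg_sub, posPart_sub_negPart]

/-! ### Loewner bounds from eigenvalues, and the second argument. -/

lemma posSemidef_smul_one_sub {A : Matrix n n ℂ} (hA : A.IsHermitian) {c : ℝ}
    (h : ∀ i, hA.eigenvalues i ≤ c) : (c • (1 : Matrix n n ℂ) - A).PosSemidef := by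
  have e : c • (1 : Matrix n n ℂ) - A = cfc (fun x => c - x) A := by
    rw [cfc_sub (fun _ => c) (fun x : ℝ => x) A, cfc_const c A hA.isSelfAdjoint, cfc_id_self hA,
      Algebra.algebraMap_eq_smul_one]
  rw [e]
  exact posSemidef_cfc hA fun i => sub_nonneg.2 (h i)

lemma minEigenvalue_le {A : Matrix n n ℂ} (hA : A.IsHermitian) (i : n) :
    minEigenvalue A ≤ hA.eigenvalues i :=
  csInf_le (Matrix.finite_real_spectrum (A := A)).bddBelow (hA.eigenvalues_mem_spectrum_real i)

lemma minEigenvalue_pos [Nonempty n] {A : Matrix n n ℂ} (hA : A.PosDef) : 0 < minEigenvalue A := by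
  have hne : (spectrum ℝ A).Nonempty :=
    ⟨_, hA.isHermitian.eigenvalues_mem_spectrum_real (Classical.arbitrary n)⟩
  have hmem := hne.csInf_mem (Matrix.finite_real_spectrum (A := A))
  rw [hA.isHermitian.spectrum_real_eq_range_eigenvalues] at hmem
  obtain ⟨i, hi⟩ := hmem
  have := hA.eigenvalues_pos i
  rw [minEigenvalue, hA.isHermitian.spectrum_real_eq_range_eigenvalues, ← hi]
  exact this

lemma posSemidef_smul_sub_one [Nonempty n] {A : Matrix n n ℂ} (hA : A.PosDef) {l : ℝ} (hl0 : 0 < l)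
    (hl : l ≤ minEigenvalue A) : (l⁻¹ • A - 1).PosSemidef := by
  have hH := hA.isHermitian
  have e : l⁻¹ • A - 1 = cfc (fun x => l⁻¹ * x - 1) A := by
    rw [cfc_sub (fun x : ℝ => l⁻¹ * x) (fun _ => 1) A, cfc_const_one ℝ A hH.isSelfAdjoint,
      cfc_const_mul l⁻¹ (fun x : ℝ => x) A, cfc_id_self hH]
  rw [e]
  refine posSemidef_cfc hH fun i => ?_
  have := hl.trans (minEigenvalue_le hH i)
  rw [sub_nonneg, inv_mul_eq_div, one_le_div hl0]
  exact this

lemma exists_exp_smul_sub_posSemidef [Nonempty n] {A S : Matrix n n ℂ} (hA : A.IsHermitian) (hS : S.PosDef) :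
    ∃ t : ℝ, 0 < t ∧ (Real.exp t • S - A).PosSemidef := by
  obtain ⟨c, hc⟩ := (Set.finite_range hA.eigenvalues).bddAbove
  have hc : ∀ i, hA.eigenvalues i ≤ max c 0 := fun i => (hc ⟨i, rfl⟩).trans (le_max_left _ _)
  have h1 := posSemidef_smul_one_sub hA hc
  have hl := minEigenvalue_pos hS
  have h2 := (posSemidef_smul_sub_one hS hl le_rfl).smul (le_max_right c 0)
  set m := max c 0 * (minEigenvalue S)⁻¹ with hm
  have hm0 : 0 ≤ m := by positivity
  -- A ≤ max c 0 • 1 ≤ m • S and m ≤ exp (m + 1); the extra 1 keeps the exponent positive when m =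
  -- 0.
  refine ⟨m + 1, by positivity, ?_⟩
  have h3 : ((Real.exp (m + 1) - m) • S).PosSemidef :=
    hS.posSemidef.smul (by linarith [Real.add_one_le_exp (m + 1)])
  have := (h1.add h2).add h3
  convert this using 1
  rw [smul_sub, smul_smul, sub_smul]
  abel

/-- If `σ₁` and `σ₂` are `δ`-close, then `σ₂ ≤ (1 + δ / l) σ₁` where `l` is a lower bound for the
spectrum of `σ₁`. -/
lemma posSemidef_one_add_smul_sub [Nonempty n] {σ₁ σ₂ : Matrix n n ℂ} (hσ₁ : IsPosDefState σ₁)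
    (hσ₂ : IsPosDefState σ₂) {δ l : ℝ} (hσ : traceDist σ₁ σ₂ ≤ δ) (hδ : 0 ≤ δ) (hl0 : 0 < l)
    (hl : l ≤ minEigenvalue σ₁) : ((1 + δ * l⁻¹) • σ₁ - σ₂).PosSemidef := by
  have hH : (σ₁ - σ₂).IsHermitian := hσ₁.1.isHermitian.sub hσ₂.1.isHermitian
  have h0 : (σ₁ - σ₂).trace = 0 := by rw [trace_sub, hσ₁.2, hσ₂.2, sub_self]
  -- A single negative part is at most the sum of all of them, which is the trace distance because
  -- the trace vanishes.
  have hb : ∀ i, -hH.eigenvalues i ≤ δ := fun i => by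
    calc -hH.eigenvalues i ≤ (hH.eigenvalues i)⁻ := neg_le_negPart _
      _ ≤ ∑ j, (hH.eigenvalues j)⁻ := Finset.single_le_sum
          (f := fun j => (hH.eigenvalues j)⁻) (fun j _ => negPart_nonneg _) (Finset.mem_univ i)
      _ ≤ δ := by rw [sum_negPart_eigenvalues hH h0]; exact hσ
  have h1 : (cfc (fun x => x + δ) (σ₁ - σ₂)).PosSemidef :=
    posSemidef_cfc hH fun i => by linarith [hb i]
  rw [← add_smul_one_eq_cfc hH] at h1
  have h2 := (posSemidef_smul_sub_one hσ₁.1 hl0 hl).smul hδ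
  convert h1.add h2 using 1
  rw [smul_sub, smul_smul, add_smul, one_smul]
  abel

lemma trace_mul_matrixLog_sub_le [Nonempty n] {ρ σ₁ σ₂ : Matrix n n ℂ} (hρ : IsState ρ)
    (hσ₁ : IsPosDefState σ₁)
    (hσ₂ : IsPosDefState σ₂) {δ l : ℝ} (hσ : traceDist σ₁ σ₂ ≤ δ) (hδ : 0 ≤ δ) (hl0 : 0 < l)
    (hl : l ≤ minEigenvalue σ₁) :
    (ρ * matrixLog σ₂).trace.re - (ρ * matrixLog σ₁).trace.re ≤ Real.log (1 + δ * l⁻¹) := by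
  have h := trace_mul_nonneg hρ.1
    (matrixLog_mono hσ₂.1 (posSemidef_one_add_smul_sub hσ₁ hσ₂ hσ hδ hl0 hl))
  rw [matrixLog_smul hσ₁.1 (by positivity)] at h
  simp only [mul_sub, mul_add, trace_sub, trace_add, mul_smul_comm, mul_one, trace_smul, hρ.2,
    Complex.sub_re, Complex.add_re, Complex.smul_re, Complex.one_re, smul_eq_mul] at h
  linarith

/-! ### The first argument. -/

section oneSided

variable {ρ₁ ρ₂ σ : Matrix n n ℂ} {ε : ℝ}

omit [DecidableEq n] in
lemma IsState.isHermitian_sub (hρ₁ : IsState ρ₁) (hρ₂ : IsState ρ₂) :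
    (ρ₁ - ρ₂).IsHermitian := hρ₁.1.isHermitian.sub hρ₂.1.isHermitian

omit [DecidableEq n] in
lemma IsState.trace_sub_eq_zero (hρ₁ : IsState ρ₁) (hρ₂ : IsState ρ₂) :
    (ρ₁ - ρ₂).trace = 0 := by
  rw [trace_sub, hρ₁.2, hρ₂.2, sub_self]

lemma sum_posPart_filter {ι : Type*} [Fintype ι] (d : ι → ℝ) :
    ∑ i with 0 < (d i)⁺, d i = ∑ i, (d i)⁺ := by
  rw [Finset.sum_filter]
  refine Finset.sum_congr rfl fun i _ => ?_
  by_cases h : 0 < (d i)⁺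
  · rw [if_pos h]
    exact (posPart_eq_self.2 (posPart_pos_iff.1 h).le).symm
  · rw [if_neg h]
    exact (le_antisymm (not_lt.1 h) (posPart_nonneg _)).symm

/-- The weight of `σ` on the support of the positive part of `ρ₁ - ρ₂`. -/
def posWeight (hΔ : (ρ₁ - ρ₂).IsHermitian) (σ : Matrix n n ℂ) : ℝ :=
  ∑ i with 0 < (hΔ.eigenvalues i)⁺, eigenDiag hΔ σ i

/-- The supports of the two parts are disjoint and σ has total weight one; the kernel of ρ₁ - ρ₂ is
discarded. -/
lemma posWeight_add_le (hΔ : (ρ₁ - ρ₂).IsHermitian) (hσ : IsPosDefState σ) :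
    ∑ i with 0 < (hΔ.eigenvalues i)⁻, eigenDiag hΔ σ i ≤ 1 - posWeight hΔ σ := by
  have h1 := sum_eigenDiag hΔ σ
  rw [hσ.2, Complex.one_re] at h1
  rw [← h1, posWeight, le_sub_iff_add_le, ← Finset.sum_union]
  · exact Finset.sum_le_sum_of_subset_of_nonneg (Finset.subset_univ _)
      fun i _ _ => (eigenDiag_pos hΔ hσ.1 i).le
  · rw [Finset.disjoint_filter]
    intro i _ h h'
    have := negPart_pos_iff.1 h
    have := posPart_pos_iff.1 h'
    linarith

/-- As ε > 0, both parts of ρ₁ - ρ₂ are nonzero, and a positive definite σ charges both supports. -/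
lemma posWeight_pos_and_lt_one (hρ₁ : IsState ρ₁) (hρ₂ : IsState ρ₂) (hσ : IsPosDefState σ)
    (hρ : traceDist ρ₁ ρ₂ = ε) (hε : 0 < ε) :
    0 < posWeight (hρ₁.isHermitian_sub hρ₂) σ ∧ posWeight (hρ₁.isHermitian_sub hρ₂) σ < 1 := by
  set hΔ := hρ₁.isHermitian_sub hρ₂
  have h0 := hρ₁.trace_sub_eq_zero hρ₂
  have aux : ∀ g : ℝ → ℝ, ∑ i, g (hΔ.eigenvalues i) = ε →
      0 < ∑ i with 0 < g (hΔ.eigenvalues i), eigenDiag hΔ σ i := by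
    intro g hg
    obtain ⟨i, -, hi⟩ := Finset.exists_lt_of_sum_lt (s := Finset.univ) (f := fun _ : n => (0 : ℝ))
      (g := fun i => g (hΔ.eigenvalues i)) (by rw [hg]; simpa using hε)
    exact Finset.sum_pos (fun i _ => eigenDiag_pos hΔ hσ.1 i) ⟨i, by simpa using hi⟩
  have hp := aux (fun x => x⁺) ((sum_posPart_eigenvalues hΔ h0).trans hρ)
  have hn := aux (fun x => x⁻) ((sum_negPart_eigenvalues hΔ h0).trans hρ)
  exact ⟨hp, by linarith [posWeight_add_le hΔ hσ]⟩

/-- Compare the weights of both sides of ρ₊ ≤ Mσ on the support of ρ₊, where ρ₊ has weight one. -/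
lemma one_le_mul_posWeight (hρ₁ : IsState ρ₁) (hρ₂ : IsState ρ₂)
    (hρ : traceDist ρ₁ ρ₂ = ε) (hε : 0 < ε) {M : ℝ}
    (hM : (M • σ - jordanPos ε ρ₁ ρ₂).PosSemidef) :
    1 ≤ M * posWeight (hρ₁.isHermitian_sub hρ₂) σ := by
  set hΔ := hρ₁.isHermitian_sub hρ₂
  have h : ∑ i with 0 < (hΔ.eigenvalues i)⁺, eigenDiag hΔ (jordanPos ε ρ₁ ρ₂) i ≤
      ∑ i with 0 < (hΔ.eigenvalues i)⁺, eigenDiag hΔ (M • σ) i :=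
    Finset.sum_le_sum fun i _ => eigenDiag_mono hΔ hM i
  simp only [eigenDiag_smul, ← Finset.mul_sum, jordanPos, posPart_eq_cfc,
    eigenDiag_cfc_self] at h
  have e : ∑ i with 0 < (hΔ.eigenvalues i)⁺, (hΔ.eigenvalues i)⁺ = ε := by
    rw [Finset.sum_filter_of_ne fun i _ h => lt_of_le_of_ne (posPart_nonneg _) h.symm,
      sum_posPart_eigenvalues hΔ (hρ₁.trace_sub_eq_zero hρ₂)]
    exact hρ
  rwa [e, inv_mul_cancel₀ hε.ne'] at h

/-- The entropic inequality `Tr ρ₁ log ρ₁ + Tr B log B ≤ Tr ρ₂ log ρ₂ + Tr A log A + h(ε)`, where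
`A` and `B` are the positive and negative parts of `ρ₁ - ρ₂`. -/
lemma trace_mul_matrixLog_add_negPart_le (hρ₁ : IsState ρ₁) (hρ₂ : IsState ρ₂)
    (hρ : traceDist ρ₁ ρ₂ = ε) (hε : ε ∈ Set.Ioo (0 : ℝ) 1) :
    (ρ₁ * matrixLog ρ₁).trace.re + ((ρ₁ - ρ₂)⁻ * matrixLog (ρ₁ - ρ₂)⁻).trace.re ≤
      (ρ₂ * matrixLog ρ₂).trace.re + ((ρ₁ - ρ₂)⁺ * matrixLog (ρ₁ - ρ₂)⁺).trace.re +
        Real.binEntropy ε := by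
  set hΔ := hρ₁.isHermitian_sub hρ₂
  have h0 := hρ₁.trace_sub_eq_zero hρ₂
  have hB : ((ρ₁ - ρ₂)⁻).PosSemidef := by
    rw [negPart_eq_cfc]
    exact posSemidef_cfc hΔ fun i => negPart_nonneg _
  have h1 := trace_mul_matrixLog_superadditive hρ₁.1 hB
  have e : ρ₁ + (ρ₁ - ρ₂)⁻ = ρ₂ + (ρ₁ - ρ₂)⁺ := by
    have := posPart_sub_negPart_eq hΔ
    rw [sub_eq_iff_eq_add] at this
    rw [this]; abel
  have hsum : ∑ i, (hΔ.eigenvalues i)⁺ = ε := (sum_posPart_eigenvalues hΔ h0).trans hρ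
  -- On this support ρ₁ - ρ₂ has weight ε, and ρ₁ at most 1.
  have hp : ∑ i with 0 < (hΔ.eigenvalues i)⁺, eigenDiag hΔ ρ₂ i ≤ 1 - ε := by
    have hd : ∀ i, eigenDiag hΔ ρ₂ i = eigenDiag hΔ ρ₁ i - hΔ.eigenvalues i := by
      intro i
      have h := eigenDiag_cfc_self hΔ (fun x => x) i
      rw [cfc_id_self hΔ, eigenDiag_sub] at h
      linarith
    simp only [hd, Finset.sum_sub_distrib, sum_posPart_filter, hsum]
    have := sum_eigenDiag hΔ ρ₁
    rw [hρ₁.2, Complex.one_re] at this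
    have h2 : ∑ i with 0 < (hΔ.eigenvalues i)⁺, eigenDiag hΔ ρ₁ i ≤ ∑ i, eigenDiag hΔ ρ₁ i :=
      Finset.sum_le_sum_of_subset_of_nonneg (Finset.filter_subset _ _)
        fun i _ _ => eigenDiag_nonneg hΔ hρ₁.1 i
    linarith
  -- With p = 1 - ε the term (p + ε) log(p + ε) vanishes and the other scalar terms form h(ε).
  have h2 := trace_mul_matrixLog_gap hΔ (g := fun x => x⁺) (fun x => posPart_nonneg x) hsum
    hε.1 hρ₂.1 (p := 1 - ε) (by linarith [hε.2]) hp
  rw [← posPart_eq_cfc, sub_add_cancel, Real.log_one] at h2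
  rw [e] at h1
  rw [Real.binEntropy_eq_negMulLog_add_negMulLog_one_sub, Real.negMulLog, Real.negMulLog]
  linarith

/-- The continuity bound for the relative entropy in its first argument. -/
lemma trace_relEntropy_sub_le (hρ₁ : IsState ρ₁) (hρ₂ : IsState ρ₂) (hσ : IsPosDefState σ)
    (hρ : traceDist ρ₁ ρ₂ = ε) (hε : ε ∈ Set.Ioo (0 : ℝ) 1) {M : ℝ}
    (hM : (M • σ - jordanPos ε ρ₁ ρ₂).PosSemidef) :
    (ρ₁ * matrixLog ρ₁ - ρ₁ * matrixLog σ).trace.re -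
      (ρ₂ * matrixLog ρ₂ - ρ₂ * matrixLog σ).trace.re ≤
        ε * Real.log (M - 1) + Real.binEntropy ε := by
  have h1 := trace_mul_matrixLog_add_negPart_le hρ₁ hρ₂ hρ hε
  have hw := one_le_mul_posWeight hρ₁ hρ₂ hρ hε.1 hM
  obtain ⟨hw0, hw1⟩ := posWeight_pos_and_lt_one hρ₁ hρ₂ hσ hρ hε.1
  have hneg := posWeight_add_le (hρ₁.isHermitian_sub hρ₂) hσ
  set hΔ := hρ₁.isHermitian_sub hρ₂
  have h0 := hρ₁.trace_sub_eq_zero hρ₂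
  have hε0 := hε.1
  have hM0 : 0 < M := by
    by_contra h
    have := mul_nonpos_of_nonpos_of_nonneg (not_lt.1 h) hw0.le
    linarith
  -- The weight w satisfies 1 ≤ M w and w < 1.
  have hM1 : 1 < M := by nlinarith
  have hq : 1 - posWeight hΔ σ ≤ (M - 1) / M := by
    rw [le_div_iff₀ hM0]; linarith
  have hA : ((ρ₁ - ρ₂)⁺).PosSemidef := by
    rw [posPart_eq_cfc]
    exact posSemidef_cfc hΔ fun i => posPart_nonneg _
  have h2 : ((ρ₁ - ρ₂)⁺ * matrixLog (ρ₁ - ρ₂)⁺).trace.re ≤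
      ((ρ₁ - ρ₂)⁺ * matrixLog ((ε * M) • σ)).trace.re := by
    refine trace_mul_matrixLog_le_of_le hA (hσ.1.smul (by positivity)) ?_
    have := hM.smul hε0.le
    rwa [smul_sub, smul_smul, jordanPos, smul_inv_smul₀ hε0.ne'] at this
  have hAt : ((ρ₁ - ρ₂)⁺).trace.re = ε := by
    rw [posPart_eq_cfc, trace_cfc hΔ, sum_posPart_eigenvalues hΔ h0]
    exact hρ
  rw [matrixLog_smul hσ.1 (by positivity), mul_add, trace_add, Complex.add_re, mul_smul_comm,
    mul_one, trace_smul, Complex.smul_re, hAt, smul_eq_mul] at h2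
  have h3 := trace_cfc_mul_matrixLog_sub_le hΔ hσ.1 (g := fun x => x⁻)
    (fun x => negPart_nonneg x) ((sum_negPart_eigenvalues hΔ h0).trans hρ) hε0
    (p := (M - 1) / M) (div_pos (by linarith) hM0) (hneg.trans hq)
  rw [← negPart_eq_cfc] at h3
  have h4 : ((ρ₁ - ρ₂)⁺ * matrixLog σ).trace.re - ((ρ₁ - ρ₂)⁻ * matrixLog σ).trace.re =
      (ρ₁ * matrixLog σ).trace.re - (ρ₂ * matrixLog σ).trace.re := by
    rw [← Complex.sub_re, ← trace_sub, ← sub_mul, posPart_sub_negPart_eq hΔ, sub_mul, trace_sub,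
      Complex.sub_re]
  have h5 : ε * Real.log (ε * M) + ε * Real.log ((M - 1) / M / ε) = ε * Real.log (M - 1) := by
    have hM' : 0 < M - 1 := by linarith
    rw [Real.log_div (by positivity) hε0.ne', Real.log_div hM'.ne' hM0.ne',
      Real.log_mul hε0.ne' hM0.ne']
    ring
  simp only [trace_sub, Complex.sub_re]
  linarith

end oneSided

/-! ### Finiteness and positivity of the max-relative entropy. -/

section maxRelEntropy

lemma maxRelEntropy_ne_top {ρ σ : Matrix n n ℂ} [Nonempty n] (hρ : ρ.IsHermitian)
    (hσ : σ.PosDef) : maxRelEntropy ρ σ ≠ ⊤ := by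
  obtain ⟨t, ht, h⟩ := exists_exp_smul_sub_posSemidef hρ hσ
  have hle : maxRelEntropy ρ σ ≤ (t : EReal) := sInf_le ⟨t, ht, h, rfl⟩
  exact (hle.trans_lt (EReal.coe_lt_top t)).ne

omit [Fintype n] [DecidableEq n] in
-- Strictness supplies a feasible t < x, so the infimum need not be attained; adding (exp x - exp t)
-- • σ then moves up to x.
lemma posSemidef_of_maxRelEntropy_lt {ρ σ : Matrix n n ℂ} (hσ : σ.PosSemidef) {x : ℝ}
    (hx : maxRelEntropy ρ σ < x) : (Real.exp x • σ - ρ).PosSemidef := by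
  obtain ⟨_, ⟨t, -, h, rfl⟩, htx⟩ := sInf_lt_iff.1 hx
  have htx := EReal.coe_lt_coe_iff.1 htx
  have := h.add (hσ.smul (sub_nonneg.2 (Real.exp_le_exp.2 htx.le)))
  convert this using 1
  rw [sub_smul]
  abel

/-- Every feasible t is at least -log w, where w < 1 is the weight of σ on the support of ρ₊. This
bound is uniform, so it passes to the infimum. -/
lemma maxRelEntropy_jordanPos_pos {ρ₁ ρ₂ σ : Matrix n n ℂ} {ε : ℝ} (hρ₁ : IsState ρ₁)
    (hρ₂ : IsState ρ₂) (hσ : IsPosDefState σ)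
    (hρ : traceDist ρ₁ ρ₂ = ε) (hε : 0 < ε) :
    0 < maxRelEntropy (jordanPos ε ρ₁ ρ₂) σ := by
  obtain ⟨hw0, hw1⟩ := posWeight_pos_and_lt_one hρ₁ hρ₂ hσ hρ hε
  have hlog := Real.log_neg hw0 hw1
  refine lt_of_lt_of_le (EReal.coe_lt_coe_iff.2 (neg_pos.2 hlog)) (le_sInf ?_)
  rintro _ ⟨t, -, h, rfl⟩
  have h1 := Real.log_nonneg (one_le_mul_posWeight hρ₁ hρ₂ hρ hε h)
  rw [Real.log_mul (Real.exp_pos t).ne' hw0.ne', Real.log_exp] at h1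
  exact EReal.coe_le_coe_iff.2 (by linarith)

end maxRelEntropy

/-! ### Combining both arguments. -/

lemma relEntropy_of_posDef (ρ : Matrix n n ℂ) {σ : Matrix n n ℂ} (hσ : σ.PosDef) :
    relEntropy ρ σ = (((ρ * matrixLog ρ - ρ * matrixLog σ).trace.re : ℝ) : EReal) := by
  rw [relEntropy, if_pos]
  have : LinearMap.ker σ.mulVecLin = ⊥ :=
    LinearMap.ker_eq_bot.2 (Matrix.mulVec_injective_of_isUnit hσ.isUnit)
  rw [this]
  exact bot_le

lemma traceDist_comm (A B : Matrix n n ℂ) : traceDist A B = traceDist B A := by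
  rw [traceDist, traceDist, ← neg_sub B A, traceNorm, traceNorm, conjTranspose_neg, neg_mul_neg]

omit [DecidableEq n] in
lemma IsState.nonempty {ρ : Matrix n n ℂ} (hρ : IsState ρ) : Nonempty n := by
  by_contra h
  have := not_nonempty_iff.1 h
  simpa [Matrix.trace] using hρ.2

/-- The continuity bound for the relative entropy in both arguments, in one direction. -/
lemma relEntropy_toReal_sub_le {ρ₁ ρ₂ σ₁ σ₂ : Matrix n n ℂ} {ε δ l M : ℝ}
    (hρ₁ : IsState ρ₁) (hρ₂ : IsState ρ₂) (hσ₁ : IsPosDefState σ₁) (hσ₂ : IsPosDefState σ₂)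
    (hε : ε ∈ Set.Ioo (0 : ℝ) 1) (hδ : 0 ≤ δ) (hρ : traceDist ρ₁ ρ₂ = ε)
    (hσ : traceDist σ₁ σ₂ ≤ δ) (hl0 : 0 < l) (hl : l ≤ minEigenvalue σ₁)
    (hM : (M • σ₁ - jordanPos ε ρ₁ ρ₂).PosSemidef) :
    (relEntropy ρ₁ σ₁).toReal - (relEntropy ρ₂ σ₂).toReal ≤
      ε * Real.log (M - 1) + Real.log (1 + δ * l⁻¹) + Real.binEntropy ε := by
  have := hρ₁.nonempty
  rw [relEntropy_of_posDef _ hσ₁.1, relEntropy_of_posDef _ hσ₂.1, EReal.toReal_coe,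
    EReal.toReal_coe]
  have h1 := trace_relEntropy_sub_le hρ₁ hρ₂ hσ₁ hρ hε hM
  have h2 := trace_mul_matrixLog_sub_le hρ₂ hσ₁ hσ₂ hσ hδ hl0 hl
  simp only [trace_sub, Complex.sub_re] at h1 ⊢
  linarith

end QuantumEntropy

end

open QuantumEntropy Filter Topology

theorem corollary1 {n : Type*} [Fintype n] [DecidableEq n]
    (ρ₁ ρ₂ σ₁ σ₂ : Matrix n n ℂ) (ε δ : ℝ)
    (hρ₁ : QuantumEntropy.IsState ρ₁) (hρ₂ : QuantumEntropy.IsState ρ₂)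
    (hσ₁ : QuantumEntropy.IsPosDefState σ₁) (hσ₂ : QuantumEntropy.IsPosDefState σ₂)
    (hε : ε ∈ Set.Ioo (0 : ℝ) 1) (hδ : δ ∈ Set.Ioo (0 : ℝ) 1)
    (hρ : QuantumEntropy.traceDist ρ₁ ρ₂ = ε)
    (hσ : QuantumEntropy.traceDist σ₁ σ₂ ≤ δ) :
    QuantumEntropy.relEntropy ρ₁ σ₁ ≠ ⊤ ∧
    QuantumEntropy.relEntropy ρ₂ σ₂ ≠ ⊤ ∧
    QuantumEntropy.maxRelEntropy (QuantumEntropy.jordanPos ε ρ₁ ρ₂) σ₁ ≠ ⊤ ∧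
    QuantumEntropy.maxRelEntropy (QuantumEntropy.jordanNeg ε ρ₁ ρ₂) σ₂ ≠ ⊤ ∧
    0 < max (QuantumEntropy.maxRelEntropy (QuantumEntropy.jordanPos ε ρ₁ ρ₂) σ₁)
      (QuantumEntropy.maxRelEntropy (QuantumEntropy.jordanNeg ε ρ₁ ρ₂) σ₂) ∧
    |(QuantumEntropy.relEntropy ρ₁ σ₁).toReal - (QuantumEntropy.relEntropy ρ₂ σ₂).toReal| ≤
      ε * Real.log (Real.exp
        (max (QuantumEntropy.maxRelEntropy (QuantumEntropy.jordanPos ε ρ₁ ρ₂) σ₁)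
          (QuantumEntropy.maxRelEntropy (QuantumEntropy.jordanNeg ε ρ₁ ρ₂) σ₂)).toReal - 1)
      + Real.log (1 + δ *
        (min (QuantumEntropy.minEigenvalue σ₁) (QuantumEntropy.minEigenvalue σ₂))⁻¹)
      + Real.binEntropy ε := by
  have := hρ₁.nonempty
  have hJ : ∀ τ₁ τ₂ : Matrix n n ℂ, (jordanPos ε τ₁ τ₂).IsHermitian := fun τ₁ τ₂ => by
    have h : IsSelfAdjoint ((τ₁ - τ₂)⁺) := (CFC.posPart_def (τ₁ - τ₂)) ▸ cfcₙ_predicate _ _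
    exact IsSelfAdjoint.smul (IsSelfAdjoint.all _) h
  have hρ' : traceDist ρ₂ ρ₁ = ε := traceDist_comm ρ₁ ρ₂ ▸ hρ
  have hσ' : traceDist σ₂ σ₁ ≤ δ := traceDist_comm σ₁ σ₂ ▸ hσ
  rw [← jordanPos_swap]
  have ht1 := maxRelEntropy_ne_top (hJ ρ₁ ρ₂) hσ₁.1
  have ht2 := maxRelEntropy_ne_top (hJ ρ₂ ρ₁) hσ₂.1
  have hpos := maxRelEntropy_jordanPos_pos hρ₁ hρ₂ hσ₁ hρ hε.1
  refine ⟨?_, ?_, ht1, ht2, lt_max_of_lt_left hpos, ?_⟩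
  · rw [relEntropy_of_posDef _ hσ₁.1]; exact EReal.coe_ne_top _
  · rw [relEntropy_of_posDef _ hσ₂.1]; exact EReal.coe_ne_top _
  set m := max (maxRelEntropy (jordanPos ε ρ₁ ρ₂) σ₁) (maxRelEntropy (jordanPos ε ρ₂ ρ₁) σ₂)
    with hm
  have hm0 : 0 < m := lt_max_of_lt_left hpos
  have hmt : m ≠ ⊤ := (max_lt ht1.lt_top ht2.lt_top).ne
  have hmr : ((m.toReal : ℝ) : EReal) = m := EReal.coe_toReal hmt (bot_le.trans_lt hm0).ne'
  have hmr0 : 0 < m.toReal := by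
    rw [← hmr] at hm0
    exact_mod_cast hm0
  set l := min (minEigenvalue σ₁) (minEigenvalue σ₂) with hl
  have hl0 : 0 < l := lt_min (minEigenvalue_pos hσ₁.1) (minEigenvalue_pos hσ₂.1)
  -- The operator inequalities are available strictly above the maximum; continuity at m, where exp
  -- m > 1, recovers the endpoint.
  have hbound : ∀ x > m.toReal, |(relEntropy ρ₁ σ₁).toReal - (relEntropy ρ₂ σ₂).toReal| ≤
      ε * Real.log (Real.exp x - 1) + Real.log (1 + δ * l⁻¹) + Real.binEntropy ε := by
    intro x hx
    have hmx : m < x := by rw [← hmr]; exact_mod_cast hx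
    obtain ⟨hx1, hx2⟩ := max_lt_iff.1 hmx
    refine abs_sub_le_iff.2 ⟨?_, ?_⟩
    · exact relEntropy_toReal_sub_le hρ₁ hρ₂ hσ₁ hσ₂ hε hδ.1.le hρ hσ hl0 (min_le_left _ _)
        (posSemidef_of_maxRelEntropy_lt hσ₁.1.posSemidef hx1)
    · exact relEntropy_toReal_sub_le hρ₂ hρ₁ hσ₂ hσ₁ hε hδ.1.le hρ' hσ' hl0 (min_le_right _ _)
        (posSemidef_of_maxRelEntropy_lt hσ₂.1.posSemidef hx2)
  have hc : ContinuousAt (fun x : ℝ =>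
      ε * Real.log (Real.exp x - 1) + Real.log (1 + δ * l⁻¹) + Real.binEntropy ε) m.toReal := by
    have hne : Real.exp m.toReal - 1 ≠ 0 := (sub_pos.2 (Real.one_lt_exp_iff.2 hmr0)).ne'
    have : ContinuousAt (fun x : ℝ => Real.log (Real.exp x - 1)) m.toReal :=
      ContinuousAt.log (by fun_prop) hne
    fun_prop
  refine ge_of_tendsto (hc.tendsto.mono_left (nhdsWithin_le_nhds (s := Set.Ioi m.toReal))) ?_
  filter_upwards [self_mem_nhdsWithin] with x hx using hbound x hx
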